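/- Let $\mathbb T^d=\mathbb R^d/\mathbb Z^d$. Let $f:\mathbb T^d\times[0,\infty)\to\mathbb R$ be continuous, strictly increasing in the second variable, and such that for some $q>1$, $C>0$ $$\tfrac1C m^{q-1}-C\le f(x,m)\le C m^{q-1}+C\qquad (x\in\mathbb T^d,\ m\ge 0).$$ Let $H:\mathbb T^d\times\mathbb R^d\to\mathbb R$ be continuous, strictly convex and differentiable in $p$, with $D_pH$ continuous in $(x,p)$, and such that for some $r>1$, $C>0$ $$\tfrac1C|p|^r-C\le H(x,p)\le C|p|^r+C\qquad (x\in\mathbb T^d,\ p\in\mathbb R^d).$$ Put $r'=r/(r-1)$, $F(x,m)=\int_0^m f(x,s)\,ds$ for $m\ge 0$, $F^*(x,a)=\sup_{m\ge0}\{am-F(x,m)\}$ and $H^*(x,v)=\sup_{p\in\mathbb R^d}\{p\cdot v-H(x,p)\}$, and assume that $H^*(\cdot,p)$ and $F(\cdot,m)$ are twice differentiable on $\mathbb T^d$ for all $p\in\mathbb R^d$ and $m\ge0$. For $\varepsilon>0$ let $K_\varepsilon$ be the set of pairs $(m,w)\in L^q(\mathbb T^d)\times L^{\frac{r'q}{r'+q-1}}(\mathbb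 T^d;\mathbb R^d)$ with $m\ge0$ a.e. and $$\int_{\mathbb T^d}D\psi\cdot w\,dx=\int_{\mathbb T^d}\varepsilon(m-1)\psi\,dx\qquad\text{for all }\psi\in C^1(\mathbb T^d),$$ and let $$\mathcal B(m,w)=\int_{\mathbb T^d} mH^*\!\left(x,-\tfrac wm\right)+F(x,m)\,dx\in\mathbb R\cup\{+\infty\},$$ where, at points with $m=0$, $mH^*(x,-w/m)$ is read as $0$ if $w=0$ and as $+\infty$ if $w\ne0$. Assume that there are functions $J:[0,\infty)\to\mathbb R$, $\tilde J:\mathbb R\to\mathbb R$ and a constant $c_0>0$ such that $$F(x,m)+F^*(x,a)-ma\ \ge\ c_0\,|J(m)-\tilde J(a)|^2\qquad\text{for all }x\in\mathbb T^d,\ m\ge0,\ a\ge\min\{0,f(x,0)\},$$ and that there is $C>0$ such that $$\sum_{i,j=1}^d\frac{\partial^2H^*}{\partial x_i\partial x_j}(x,p)h_ih_j\le C(|p|^{r'}+1)|h|^2,\qquad \sum_{i,j=1}^d\frac{\partial^2F}{\partial x_i\partial x_j}(x,m)h_ih_j\le C(m^q+1)|h|^2$$ for all $x\in\mathbb T^d$,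 $p,h\in\mathbb R^d$ and $m\ge0$. Then there is a constant $C\ge 0$, independent of $\varepsilon$, such that for every $\varepsilon>0$ and every minimiser $(m^\varepsilon,w^\varepsilon)$ of $\mathcal B$ over $K_\varepsilon$ one has $J(m^\varepsilon)\in H^1(\mathbb T^d)$ and $$\|J(m^\varepsilon)\|_{H^1(\mathbb T^d)}\le C.$$ -/

import Mathlib

open MeasureTheory Set
open scoped ENNReal NNReal ContDiff

noncomputable section

namespace DiscountMFG

/-- Euclidean space `ℝᵈ`. -/
abbrev E (d : ℕ) := EuclideanSpace ℝ (Fin d)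

/-- The flat torus `𝕋ᵈ = (ℝ/ℤ)ᵈ`; its `volume` is the product measure, of total mass one. -/
abbrev T (d : ℕ) := UnitAddTorus (Fin d)

variable {d : ℕ}

/-- The covering map `ℝᵈ → 𝕋ᵈ`. -/
def proj (v : E d) : T d := fun i => (v i : UnitAddCircle)

/-- `ψ ∈ Cⁿ(𝕋ᵈ)`: the periodic lift of `ψ` to `ℝᵈ` is `Cⁿ`. -/
def IsCk (n : WithTop ℕ∞) (ψ : T d → ℝ) : Prop := ContDiff ℝ n (fun v : E d => ψ (proj v))

/-- The gradient `Dψ(x)` of a function on the torus. -/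
def grad (ψ : T d → ℝ) (x : T d) : E d := gradient (fun v : E d => ψ (x + proj v)) 0

/-- `φ` is twice differentiable on the torus, i.e. its periodic lift is differentiable everywhere
and the derivative of the lift is differentiable everywhere. -/
def TwiceDiff (φ : T d → ℝ) : Prop :=
  Differentiable ℝ (fun v : E d => φ (proj v)) ∧
    Differentiable ℝ (fderiv ℝ (fun v : E d => φ (proj v)))

/-- The Hessian form `∑ᵢⱼ ∂²φ/∂xᵢ∂xⱼ hᵢ hⱼ`, evaluated at the point of the torus below `v`. -/
def hess (φ : T d → ℝ) (v h : E d) : ℝ :=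
  fderiv ℝ (fderiv ℝ (fun u : E d => φ (proj u))) v h h

/-! ### The Sobolev space `H¹(𝕋ᵈ)` -/

/-- `G` is the weak gradient of `g`. -/
def IsWeakGrad (g : T d → ℝ) (G : T d → E d) : Prop :=
  Integrable g ∧ Integrable G ∧
    ∀ ψ : T d → ℝ, IsCk ∞ ψ → ∫ x, g x • grad ψ x = -∫ x, ψ x • G x

/-- `g ∈ H¹(𝕋ᵈ)`. -/
def MemH1 (g : T d → ℝ) : Prop :=
  MemLp g 2 ∧ ∃ G : T d → E d, IsWeakGrad g G ∧ MemLp G 2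

/-- The norm `(‖g‖² + ‖Dg‖²)^(1/2)` of `H¹(𝕋ᵈ)`. The weak gradient is unique up to null sets, so
the infimum has a single value; it is `∞` if `g` has no weak gradient. -/
def h1Norm (g : T d → ℝ) : ℝ≥0∞ :=
  ⨅ (G : T d → E d) (_ : IsWeakGrad g G),
    (eLpNorm g 2 volume ^ 2 + eLpNorm G 2 volume ^ 2) ^ (1 / 2 : ℝ)

/-! ### The data of the mean field game -/

/-- The assumptions on the coupling `f : 𝕋ᵈ × [0, ∞) → ℝ`; the values `f x m` with `m < 0` are
never used. -/
structure CouplingHyp (f : T d → ℝ → ℝ) (q : ℝ) : Prop where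
  one_lt : 1 < q
  continuousOn : ContinuousOn (fun z : T d × ℝ => f z.1 z.2) (univ ×ˢ Ici 0)
  strictMonoOn : ∀ x, StrictMonoOn (f x) (Ici 0)
  growth : ∃ C > 0, ∀ x, ∀ m : ℝ, 0 ≤ m →
    1 / C * m ^ (q - 1) - C ≤ f x m ∧ f x m ≤ C * m ^ (q - 1) + C

/-- The assumptions on the Hamiltonian `H : 𝕋ᵈ × ℝᵈ → ℝ`. -/
structure HamiltonianHyp (H : T d → E d → ℝ) (r : ℝ) : Prop where
  one_lt : 1 < r
  continuous : Continuous (fun z : T d × E d => H z.1 z.2)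
  strictConvexOn : ∀ x, StrictConvexOn ℝ univ (H x)
  differentiable : ∀ x, Differentiable ℝ (H x)
  continuous_gradient : Continuous (fun z : T d × E d => gradient (H z.1) z.2)
  growth : ∃ C > 0, ∀ x, ∀ p : E d,
    1 / C * ‖p‖ ^ r - C ≤ H x p ∧ H x p ≤ C * ‖p‖ ^ r + C

/-- The primitive `F(x,m) = ∫₀ᵐ f(x,s) ds`, used for `m ≥ 0` only (`F = +∞` for `m < 0`). -/
def primF (f : T d → ℝ → ℝ) (x : T d) (m : ℝ) : ℝ := ∫ s in (0 : ℝ)..m, f x s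

/-- The conjugate `F*(x,a) = sup_{m ≥ 0} (a m - F(x,m))`. -/
def conjF (f : T d → ℝ → ℝ) (x : T d) (a : ℝ) : ℝ := ⨆ m : ℝ≥0, (a * m - primF f x m)

/-- The conjugate `H*(x,v) = sup_p (p · v - H(x,p))`. -/
def conjH (H : T d → E d → ℝ) (x : T d) (v : E d) : ℝ := ⨆ p : E d, (inner ℝ p v - H x p)

/-! ### The dual problem -/

/-- The set `K_ε` of admissible pairs, with `ε m + div w = ε` in the sense of distributions. -/
structure Admissible (q r ε : ℝ) (m : T d → ℝ) (w : T d → E d) : Prop where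
  memLp_m : MemLp m (ENNReal.ofReal q)
  memLp_w : MemLp w (ENNReal.ofReal (r.conjExponent * q / (r.conjExponent + q - 1)))
  nonneg : ∀ᵐ x, 0 ≤ m x
  equation : ∀ ψ : T d → ℝ, IsCk 1 ψ →
    ∫ x, inner ℝ (grad ψ x) (w x) = ∫ x, ε * (m x - 1) * ψ x

/-- The integrand `m H*(x, -w/m) + F(x,m)` at the points where it is finite. At `m = 0`, `w = 0`
it is `0`. -/
def integrandB (f : T d → ℝ → ℝ) (H : T d → E d → ℝ) (m : T d → ℝ) (w : T d → E d) (x : T d) : ℝ :=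
  m x * conjH H x (-((m x)⁻¹ • w x)) + primF f x (m x)

open Classical in
/-- The functional `𝓑(m,w) = ∫ m H*(x, -w/m) + F(x,m) dx` with values in `ℝ ∪ {+∞}`. The integrand
is `+∞` where `m = 0` and `w ≠ 0`. For admissible pairs the integrand is measurable and its negative
part is integrable, so the integral is `+∞` exactly if the integrand is `+∞` on a set of positive
measure or is not integrable. -/
def dualB (f : T d → ℝ → ℝ) (H : T d → E d → ℝ) (m : T d → ℝ) (w : T d → E d) : EReal :=
  if (∀ᵐ x, m x = 0 → w x = 0) ∧ Integrable (integrandB f H m w) then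
    ((∫ x, integrandB f H m w x : ℝ) : EReal)
  else ⊤

/-- `(m,w)` minimises `𝓑` over `K_ε`. -/
def IsDualMinimizer (f : T d → ℝ → ℝ) (H : T d → E d → ℝ) (q r ε : ℝ)
    (m : T d → ℝ) (w : T d → E d) : Prop :=
  Admissible q r ε m w ∧
    ∀ (m' : T d → ℝ) (w' : T d → E d), Admissible q r ε m' w' → dualB f H m w ≤ dualB f H m' w'

end DiscountMFG

end

noncomputable section

namespace DiscountMFG

section

variable {d : ℕ}

/-! ### Calculus on the torus -/

/-! The energy density is convex in `(m, w)`: `m H*(x, -w/m)` is a supremum of linear functions of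
`(m, w)`, and the gap hypothesis makes `F` uniformly convex when distances are measured through `J`
(`CouplingHyp.sq_sub_le`, `midpoint_density_le`).

The set `K_ε` is convex and invariant under translations, its equation having constant coefficients.
The midpoint of a minimiser and its translate by `u` is thus a competitor, and minimality gives
`c₀/2 ∫ |J(m(x+u)) - J(m(x))|² ≤ 𝓑(translate) - 𝓑(m,w)`
(`IsDualMinimizer.integral_sq_translate_le`). A change of variables turns the right side into the
effect of shifting only the explicit `x`-dependence of the density, with `m` and `w` frozen. Adding
the inequalities for `u` and `-u` leaves a second difference in `x`, which the one-sided Hessian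
bounds control by `(m |w/m|^{r'} + m^q + 1) |u|²` up to a constant
(`IsDualMinimizer.integral_sq_difference_le`).

Comparison with the pair `(1, 0)`, which lies in every `K_ε`, bounds the integral of that weight
uniformly in `ε` (`exists_integral_modelDensity_le`). So the translates of `J(m)` differ from it by
`O(|u|)` in `L²`, and Riesz representation yields a weak gradient
(`exists_weakGrad_of_difference_le`). The `L²` norm itself is controlled by `J(m)² ≤ K (m^q + 1)`.
-/

@[simp]
lemma proj_zero : proj (0 : E d) = 0 := by
  ext i; simp [proj]

lemma proj_add (u v : E d) : proj (u + v) = proj u + proj v := by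
  ext i; simp [proj]

lemma proj_neg (u : E d) : proj (-u) = -proj u := by
  ext i; simp [proj]

lemma proj_sub (u v : E d) : proj (u - v) = proj u - proj v := by
  ext i; simp [proj]

/-- Continuity on the torus can then be tested on periodic lifts, and every point of the torus has a
lift. -/
lemma isOpenQuotientMap_proj : IsOpenQuotientMap (proj : E d → T d) := by
  have h : IsOpenQuotientMap (Pi.map fun (_ : Fin d) (t : ℝ) => (t : UnitAddCircle)) :=
    IsOpenQuotientMap.piMap fun _ => QuotientAddGroup.isOpenQuotientMap_mk
  exact h.comp (EuclideanSpace.equiv (Fin d) ℝ).toHomeomorph.isOpenQuotientMap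

lemma continuous_of_lift {Y : Type*} [TopologicalSpace Y] {g : T d → Y}
    (h : Continuous fun v : E d => g (proj v)) : Continuous g :=
  isOpenQuotientMap_proj.isQuotientMap.continuous_iff.2 h

lemma grad_proj (ψ : T d → ℝ) (v : E d) :
    grad ψ (proj v) = gradient (fun u : E d => ψ (proj u)) v := by
  have h : (fun u : E d => ψ (proj v + proj u)) = fun u => (fun u : E d => ψ (proj u)) (v + u) := by
    ext u; simp [proj_add]
  rw [grad, h, gradient, gradient, fderiv_comp_add_left (f := fun u : E d => ψ (proj u)), add_zero]

lemma IsCk.continuous {n : WithTop ℕ∞} {ψ : T d → ℝ} (h : IsCk n ψ) : Continuous ψ :=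
  continuous_of_lift (ContDiff.continuous h)

lemma IsCk.continuous_grad {n : WithTop ℕ∞} (hn : n ≠ 0) {ψ : T d → ℝ} (h : IsCk n ψ) :
    Continuous (grad ψ) := by
  refine continuous_of_lift ?_
  simp_rw [grad_proj]
  exact (InnerProductSpace.toDual ℝ (E d)).symm.continuous.comp (ContDiff.continuous_fderiv h hn)

lemma IsCk.hasGradientAt_translate {n : WithTop ℕ∞} (hn : n ≠ 0) {ψ : T d → ℝ} (h : IsCk n ψ)
    (x : T d) (v : E d) :
    HasGradientAt (fun u : E d => ψ (x + proj u)) (grad ψ (x + proj v)) v := by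
  obtain ⟨u₀, rfl⟩ := isOpenQuotientMap_proj.surjective x
  rw [← proj_add, grad_proj]
  have h1 : HasFDerivAt (fun u : E d => ψ (proj u)) (fderiv ℝ (fun u : E d => ψ (proj u)) (u₀ + v))
      (u₀ + v) := (ContDiff.differentiable h hn _).hasFDerivAt
  have h2 := h1.comp v ((hasFDerivAt_id v).const_add u₀)
  rw [hasGradientAt_iff_hasFDerivAt, gradient, LinearIsometryEquiv.apply_symm_apply]
  simp only [← proj_add]
  exact h2

lemma IsCk.translate {n : WithTop ℕ∞} {ψ : T d → ℝ} (h : IsCk n ψ) (u : E d) :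
    IsCk n (fun x => ψ (x + proj u)) := by
  have h1 : ContDiff ℝ n (fun v : E d => v + u) := contDiff_id.add contDiff_const
  have := ContDiff.comp h h1
  simpa [IsCk, Function.comp_def, proj_add] using this

lemma grad_translate (ψ : T d → ℝ) (u : T d) (x : T d) :
    grad (fun y => ψ (y + u)) x = grad ψ (x + u) := by
  unfold grad
  congr 1
  ext v
  rw [add_right_comm]

/-- A function with second derivative bounded above is semiconcave. -/
lemma second_difference_le {φ : E d → ℝ} (h1 : Differentiable ℝ φ)
    (h2 : Differentiable ℝ (fderiv ℝ φ)) (h : E d) {M : ℝ}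
    (hM : ∀ v, fderiv ℝ (fderiv ℝ φ) v h h ≤ M) (v : E d) :
    φ (v + h) + φ (v - h) - 2 * φ v ≤ M := by
  have hl : ∀ s : ℝ, HasDerivAt (fun s : ℝ => v + s • h) h s := fun s => by
    simpa using ((hasDerivAt_id s).smul_const h).const_add v
  have d1 : ∀ s : ℝ, HasDerivAt (fun s : ℝ => φ (v + s • h)) (fderiv ℝ φ (v + s • h) h) s :=
    fun s => (h1 _).hasFDerivAt.comp_hasDerivAt s (hl s)
  have d2 : ∀ s : ℝ, HasDerivAt (fun s : ℝ => fderiv ℝ φ (v + s • h) h)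
      (fderiv ℝ (fderiv ℝ φ) (v + s • h) h h) s := fun s => by
    have := (h2 (v + s • h)).hasFDerivAt.comp_hasDerivAt s (hl s)
    simpa using this.clm_apply (hasDerivAt_const s h)
  have e1 : ∀ s : ℝ, HasDerivAt (fun s : ℝ => φ (v + s • h) - M / 2 * s ^ 2)
      (fderiv ℝ φ (v + s • h) h - M * s) s := fun s => by
    have := (d1 s).sub (((hasDerivAt_id s).pow 2).const_mul (M / 2))
    refine this.congr_deriv ?_
    simp; ring
  have e2 : ∀ s : ℝ, HasDerivAt (fun s : ℝ => fderiv ℝ φ (v + s • h) h - M * s)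
      (fderiv ℝ (fderiv ℝ φ) (v + s • h) h h - M) s := fun s => by
    exact ((d2 s).sub ((hasDerivAt_id s).const_mul M)).congr_deriv (by simp)
  have hd : deriv (fun s : ℝ => φ (v + s • h) - M / 2 * s ^ 2) =
      fun s => fderiv ℝ φ (v + s • h) h - M * s := funext fun s => (e1 s).deriv
  -- Subtracting `M s² / 2` makes the second derivative along the line nonpositive. Midpoint
  -- concavity at `s = ±1` is the claim; it needs no continuity of the second derivative.
  have hc : ConcaveOn ℝ univ (fun s : ℝ => φ (v + s • h) - M / 2 * s ^ 2) := by
    refine concaveOn_univ_of_deriv2_nonpos (fun s => (e1 s).differentiableAt) ?_ ?_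
    · rw [hd]; exact fun s => (e2 s).differentiableAt
    · intro s
      simp only [Function.iterate_succ, Function.iterate_zero, Function.comp_apply, id]
      rw [hd, (e2 s).deriv]
      linarith [hM (v + s • h)]
  have := hc.2 (mem_univ (1 : ℝ)) (mem_univ (-1 : ℝ))
    (show (0 : ℝ) ≤ 1 / 2 by norm_num) (show (0 : ℝ) ≤ 1 / 2 by norm_num) (by norm_num)
  simp only [smul_eq_mul] at this
  norm_num at this
  rw [← sub_eq_add_neg] at this
  linarith

/-- The second difference of a twice differentiable function on the torus. -/
lemma TwiceDiff.second_difference_le {φ : T d → ℝ} (hφ : TwiceDiff φ) (h : E d) {M : ℝ}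
    (hM : ∀ v, hess φ v h ≤ M) (x : T d) :
    φ (x + proj h) + φ (x - proj h) - 2 * φ x ≤ M := by
  obtain ⟨v, rfl⟩ := isOpenQuotientMap_proj.surjective x
  rw [← proj_add, ← proj_sub]
  exact DiscountMFG.second_difference_le hφ.1 hφ.2 h hM v

end

section

variable {d : ℕ}

/-! ### Weak gradients from difference quotients -/

/-- A linear functional that is bounded by the norm of a linear map into a Hilbert space is
represented by a vector of that space. -/
lemma exists_inner_eq_of_le {V W : Type*} [AddCommGroup V] [Module ℝ V] [NormedAddCommGroup W]
    [InnerProductSpace ℝ W] [CompleteSpace W] (L : V →ₗ[ℝ] W) (l : V →ₗ[ℝ] ℝ) {C : ℝ} (hC : 0 ≤ C)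
    (h : ∀ v, |l v| ≤ C * ‖L v‖) : ∃ G : W, ‖G‖ ≤ C ∧ ∀ v, l v = inner ℝ G (L v) := by
  -- The bound forces `l` to vanish on the kernel of `L`, so `l` factors through the range of `L`.
  -- The range need not be closed, hence Hahn–Banach before Riesz.
  have hker : L.ker ≤ l.ker := fun v hv => by
    have := h v
    rw [LinearMap.mem_ker.1 hv, norm_zero, mul_zero] at this
    exact abs_nonpos_iff.1 this
  let l' : L.range →ₗ[ℝ] ℝ := L.ker.liftQ l hker ∘ₗ L.quotKerEquivRange.symm.toLinearMap
  have hl' : ∀ v, l' ⟨L v, LinearMap.mem_range_self L v⟩ = l v := fun v => by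
    have : L.quotKerEquivRange.symm ⟨L v, LinearMap.mem_range_self L v⟩ = L.ker.mkQ v :=
      LinearMap.quotKerEquivRange_symm_apply_image L v _
    simp [l', this]
  have hb : ∀ y : L.range, ‖l' y‖ ≤ C * ‖y‖ := by
    rintro ⟨_, v, rfl⟩
    rw [hl' v]
    exact h v
  obtain ⟨g, hg, hn⟩ := exists_extension_norm_eq L.range (l'.mkContinuous C hb)
  refine ⟨(InnerProductSpace.toDual ℝ W).symm g, ?_, fun v => ?_⟩
  · rw [LinearIsometryEquiv.norm_map, hn]
    exact l'.mkContinuous_norm_le hC hb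
  · rw [InnerProductSpace.toDual_symm_apply, ← hl' v]
    exact (hg ⟨L v, LinearMap.mem_range_self L v⟩).symm

lemma norm_toLp_two {α : Type*} [MeasurableSpace α] {μ : Measure α} {u : α → ℝ}
    (hu : MemLp u 2 μ) : ‖hu.toLp u‖ = √(∫ x, u x ^ 2 ∂μ) := by
  rw [← Real.sqrt_sq (norm_nonneg (hu.toLp u)), ← real_inner_self_eq_norm_sq, L2.inner_def]
  congr 1
  refine integral_congr_ae ?_
  filter_upwards [hu.coeFn_toLp] with x hx
  rw [hx, real_inner_self_eq_norm_sq, Real.norm_eq_abs, sq_abs]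

lemma inner_toLp_two {α : Type*} [MeasurableSpace α] {μ : Measure α} {u v : α → ℝ}
    (hu : MemLp u 2 μ) (hv : MemLp v 2 μ) :
    inner ℝ (hu.toLp u) (hv.toLp v) = ∫ x, u x * v x ∂μ := by
  rw [L2.inner_def]
  refine integral_congr_ae ?_
  filter_upwards [hu.coeFn_toLp, hv.coeFn_toLp] with x hx hy
  rw [hx, hy]
  simp [mul_comm]

lemma memLp_of_continuous {Y : Type*} [NormedAddCommGroup Y] {ψ : T d → Y} (h : Continuous ψ)
    (p : ℝ≥0∞) : MemLp ψ p := by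
  obtain ⟨C, hC⟩ := isCompact_univ.exists_bound_of_continuousOn h.continuousOn
  exact MemLp.of_bound (h.aestronglyMeasurable_of_compactSpace) C (.of_forall fun x => hC x trivial)

/-- The smooth functions on the torus, as a vector space. -/
def smoothFunctions (d : ℕ) : Submodule ℝ (T d → ℝ) where
  carrier := {ψ | IsCk ∞ ψ}
  add_mem' {ψ φ} (hψ : IsCk ∞ ψ) (hφ : IsCk ∞ φ) :=
    show IsCk ∞ (ψ + φ) from ContDiff.add (𝕜 := ℝ) hψ hφ
  zero_mem' := show IsCk ∞ (0 : T d → ℝ) from contDiff_const (𝕜 := ℝ) (c := (0 : ℝ))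
  smul_mem' c ψ (hψ : IsCk ∞ ψ) := show IsCk ∞ (c • ψ) from ContDiff.const_smul (𝕜 := ℝ) c hψ

lemma isCk_coe (ψ : smoothFunctions d) : IsCk ∞ (ψ : T d → ℝ) := ψ.2

lemma grad_add {ψ φ : T d → ℝ} (hψ : IsCk ∞ ψ) (hφ : IsCk ∞ φ) :
    grad (ψ + φ) = grad ψ + grad φ := by
  ext1 x
  have h1 := hψ.hasGradientAt_translate (by simp) x 0
  have h2 := hφ.hasGradientAt_translate (by simp) x 0
  have := (h1.hasFDerivAt.add h2.hasFDerivAt)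
  rw [← map_add] at this
  refine (HasGradientAt.gradient (hasGradientAt_iff_hasFDerivAt.2 this)).trans ?_
  simp

lemma grad_smul {ψ : T d → ℝ} (hψ : IsCk ∞ ψ) (c : ℝ) : grad (c • ψ) = c • grad ψ := by
  ext1 x
  have h1 := hψ.hasGradientAt_translate (by simp) x 0
  have := h1.hasFDerivAt.const_smul c
  have h3 : c • (InnerProductSpace.toDual ℝ (E d)) (grad ψ (x + proj 0)) =
    (InnerProductSpace.toDual ℝ (E d)) (c • grad ψ (x + proj 0)) := by simp
  rw [h3] at this
  refine (HasGradientAt.gradient (hasGradientAt_iff_hasFDerivAt.2 this)).trans ?_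
  simp

lemma measurePreserving_translate (a : T d) :
    MeasurePreserving (fun x : T d => x + a) volume volume :=
  measurePreserving_add_right volume a

/-- The pairing of a function that has bounded difference quotients with a directional derivative
of a test function. -/
lemma abs_integral_mul_deriv_le {g : T d → ℝ} (hg : MemLp g 2) {K : ℝ} (hK : 0 ≤ K)
    (h : ∀ u : E d, ∫ x, (g (x + proj u) - g x) ^ 2 ≤ (K * ‖u‖) ^ 2)
    {ψ : T d → ℝ} (hψ : IsCk ∞ ψ) (e : E d) :
    |∫ x, g x * inner ℝ (grad ψ x) e| ≤
      K * ‖e‖ * ‖(memLp_of_continuous hψ.continuous 2).toLp ψ‖ := by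
  have hg1 : Integrable g := hg.integrable (by norm_num)
  have hcg : Continuous (grad ψ) := hψ.continuous_grad (by simp)
  obtain ⟨M, hM⟩ := isCompact_univ.exists_bound_of_continuousOn hcg.continuousOn
  have hintegral : ∀ a : T d, Integrable (fun x : T d => g x * ψ (x + a)) volume := fun a =>
    hg.integrable_mul (q := 2) (memLp_of_continuous
      (hψ.continuous.comp (continuous_id.add continuous_const)) 2)
  have hder := (hasDerivAt_integral_of_dominated_loc_of_deriv_le (μ := volume) (𝕜 := ℝ)
    (F := fun t x => g x * ψ (x + proj (t • e)))
    (F' := fun t x => g x * inner ℝ (grad ψ (x + proj (t • e))) e)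
    (bound := fun x => |g x| * (M * ‖e‖)) (x₀ := 0) (s := univ) Filter.univ_mem
    (.of_forall fun t => (hintegral _).aestronglyMeasurable) (hintegral _)
    ?_ ?_ (hg1.abs.mul_const _) ?_).2
  · simp only [zero_smul, proj_zero, add_zero] at hder
    -- The integral is the derivative at `t = 0` of `t ↦ ∫ g(x) ψ(x + te) dx`, so it is bounded by
    -- any Lipschitz constant at `0`. Moving the translation from `ψ` onto `g` makes the increment a
    -- pairing of `ψ` with a difference of `g`.
    refine hder.le_of_lip' (C := K * ‖e‖ * ‖(memLp_of_continuous hψ.continuous 2).toLp ψ‖)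
      (by positivity) (.of_forall fun t => ?_)
    have e1 : ∫ x, g x * ψ (x + proj (t • e)) = ∫ x, g (x + proj (-(t • e))) * ψ x := by
      rw [← integral_add_right_eq_self (fun x => g (x + proj (-(t • e))) * ψ x) (proj (t • e))]
      simp [proj_neg]
    have hgt : MemLp (fun x => g (x + proj (-(t • e)))) 2 :=
      hg.comp_measurePreserving (measurePreserving_translate _)
    have hd : MemLp (fun x => g (x + proj (-(t • e))) - g x) 2 := hgt.sub hg
    have hψ2 := memLp_of_continuous hψ.continuous 2
    simp only [zero_smul, proj_zero, add_zero]
    have e2 : (∫ x, g (x + proj (-(t • e))) * ψ x) - ∫ x, g x * ψ x =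
        ∫ x, (g (x + proj (-(t • e))) - g x) * ψ x := by
      simp_rw [sub_mul]
      exact (integral_sub (hgt.integrable_mul (q := 2) hψ2) (hg.integrable_mul (q := 2) hψ2)).symm
    rw [e1, e2]
    rw [← inner_toLp_two hd hψ2]
    refine (norm_inner_le_norm _ _).trans ?_
    have : ‖hd.toLp _‖ ≤ K * ‖e‖ * ‖t - 0‖ := by
      rw [norm_toLp_two]
      refine (Real.sqrt_le_sqrt (h (-(t • e)))).trans ?_
      rw [Real.sqrt_sq (by positivity), norm_neg, norm_smul, sub_zero]
      exact le_of_eq (by ring)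
    calc _ ≤ K * ‖e‖ * ‖t - 0‖ * ‖hψ2.toLp ψ‖ := by gcongr
      _ = _ := by ring
  · refine hg1.aestronglyMeasurable.mul ?_
    refine Continuous.aestronglyMeasurable_of_compactSpace ?_
    fun_prop
  · refine .of_forall fun x t _ => ?_
    rw [norm_mul, Real.norm_eq_abs]
    gcongr
    refine (norm_inner_le_norm _ _).trans ?_
    gcongr
    exact hM _ trivial
  · refine .of_forall fun x t _ => ?_
    have h1 := (hψ.hasGradientAt_translate (by simp) x (t • e)).hasFDerivAt.comp_hasDerivAt t
      ((hasDerivAt_id t).smul_const e)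
    simpa using h1.const_mul (g x)

/-- By the difference bound, `ψ ↦ ∫ g ∂ᵢψ` is continuous for the `L²` norm of `ψ`, so it is
represented by an `L²` function for each `i`. The factor `d` comes from the triangle inequality over
the components. -/
lemma exists_weakGrad_of_difference_le {g : T d → ℝ} (hg : MemLp g 2) {K : ℝ} (hK : 0 ≤ K)
    (h : ∀ u : E d, ∫ x, (g (x + proj u) - g x) ^ 2 ≤ (K * ‖u‖) ^ 2) :
    ∃ G : T d → E d, IsWeakGrad g G ∧ MemLp G 2 ∧ eLpNorm G 2 volume ≤ d * ENNReal.ofReal K := by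
  have hg1 : Integrable g := hg.integrable (by norm_num)
  have key : ∀ i : Fin d, ∃ Gi : T d → ℝ, MemLp Gi 2 ∧ eLpNorm Gi 2 volume ≤ ENNReal.ofReal K ∧
      ∀ ψ : T d → ℝ, IsCk ∞ ψ → ∫ x, g x * grad ψ x i = -∫ x, ψ x * Gi x := by
    intro i
    have hintegral : ∀ ψ : T d → ℝ, IsCk ∞ ψ → Integrable (fun x => g x * grad ψ x i) := fun ψ hψ =>
      hg.integrable_mul (q := 2) (memLp_of_continuous (by
        have := hψ.continuous_grad (by simp)
        fun_prop) 2)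
    let L : smoothFunctions d →ₗ[ℝ] Lp ℝ 2 (volume : Measure (T d)) :=
      { toFun := fun ψ => (memLp_of_continuous ((isCk_coe ψ).continuous) 2).toLp ψ.1
        map_add' := fun ψ φ => rfl
        map_smul' := fun c ψ => rfl }
    have hL : ∀ ψ : smoothFunctions d,
        L ψ = (memLp_of_continuous (isCk_coe ψ).continuous 2).toLp ψ.1 := fun _ => rfl
    let l : smoothFunctions d →ₗ[ℝ] ℝ :=
      { toFun := fun ψ => ∫ x, g x * grad ψ.1 x i
        map_add' := fun ψ φ => by
          rw [← integral_add (hintegral _ (isCk_coe ψ)) (hintegral _ (isCk_coe φ))]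
          simp [grad_add (isCk_coe ψ) (isCk_coe φ), mul_add]
        map_smul' := fun c ψ => by
          rw [RingHom.id_apply, smul_eq_mul, ← integral_const_mul]
          simp [grad_smul (isCk_coe ψ), mul_left_comm] }
    obtain ⟨G, hG, hGl⟩ := exists_inner_eq_of_le L l hK (fun ψ => by
      have := abs_integral_mul_deriv_le hg hK h (isCk_coe ψ) (EuclideanSpace.single i 1)
      rw [hL]
      simpa [EuclideanSpace.inner_single_right, l] using this)
    -- The sign is that of integration by parts: `G` represents `ψ ↦ ∫ g ∂ᵢψ`, which is minus the
    -- weak derivative.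
    refine ⟨fun x => -G x, (Lp.memLp G).neg, ?_, fun ψ hψ => ?_⟩
    · have e1 : eLpNorm (fun x => -G x) 2 volume = eLpNorm G 2 volume := eLpNorm_neg ..
      rw [e1, ← ENNReal.ofReal_toReal (Lp.eLpNorm_ne_top G), ← Lp.norm_def]
      exact ENNReal.ofReal_le_ofReal hG
    · have := hGl ⟨ψ, hψ⟩
      simp only [mul_neg, integral_neg, neg_neg]
      refine this.trans ?_
      rw [L2.inner_def, hL]
      refine integral_congr_ae ?_
      filter_upwards [(memLp_of_continuous hψ.continuous 2).coeFn_toLp] with x hx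
      rw [hx]
      simp
  choose Gi hGi hGn hGw using key
  have hG : MemLp (fun x => (WithLp.toLp 2 fun i => Gi i x : E d)) 2 volume :=
    MemLp.of_eval_piLp fun i => hGi i
  refine ⟨fun x => WithLp.toLp 2 fun i => Gi i x, ⟨hg1, hG.integrable (by norm_num), ?_⟩, hG, ?_⟩
  · intro ψ hψ
    have hcg : Continuous (grad ψ) := hψ.continuous_grad (by simp)
    ext i
    rw [PiLp.neg_apply, eval_integral_piLp, eval_integral_piLp]
    · simpa using hGw i ψ hψ
    · intro j
      exact (memLp_of_continuous hψ.continuous 2).integrable_mul (hGi j)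
    · intro j
      exact hg.integrable_mul (q := 2) (memLp_of_continuous (ψ := fun x => grad ψ x j)
        (by fun_prop) 2)
  · have e1 : (fun x => (WithLp.toLp 2 fun i => Gi i x : E d)) =
        ∑ i, fun x => Gi i x • EuclideanSpace.single i (1 : ℝ) := by
      ext x j
      simp [Finset.sum_apply, Pi.single_apply]
    rw [e1]
    refine (eLpNorm_sum_le (fun i _ => (hGi i).1.smul_const _) (by norm_num)).trans ?_
    calc _ ≤ ∑ i : Fin d, ENNReal.ofReal K := by
          refine Finset.sum_le_sum fun i _ => (eLpNorm_mono fun x => ?_).trans (hGn i)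
          rw [norm_smul]
          simp
      _ = _ := by simp

end

section

variable {d : ℕ} {f : T d → ℝ → ℝ} {H : T d → E d → ℝ} {q r : ℝ}

/-! ### Growth of the conjugate Hamiltonian -/

/-- Young's inequality with an arbitrarily small weight `a`, without the sharp constant: either `b ≤
a m^(s-1)` and the first term suffices, or `m` is at most `(b/a)^(1/(s-1))` and the second does. -/
lemma exists_mul_le_rpow_add {s a : ℝ} (hs : 1 < s) (ha : 0 < a) :
    ∃ K ≥ 0, ∀ m b : ℝ, 0 ≤ m → 0 ≤ b → b * m ≤ a * m ^ s + K * b ^ s.conjExponent := by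
  refine ⟨(a⁻¹) ^ (1 / (s - 1)), by positivity, fun m b hm hb => ?_⟩
  have hs' : 0 < s - 1 := by linarith
  rcases le_or_gt b (a * m ^ (s - 1)) with h | h
  · have h1 : m ^ (s - 1) * m = m ^ s := by
      rw [← Real.rpow_add_one' hm (by linarith)]; ring_nf
    have h2 : 0 ≤ a⁻¹ ^ (1 / (s - 1)) * b ^ s.conjExponent := by positivity
    nlinarith [mul_le_mul_of_nonneg_right h hm]
  · have hb' : 0 < b := lt_of_le_of_lt (by positivity) h
    have h1 : m ≤ (a⁻¹ * b) ^ (1 / (s - 1)) := by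
      rw [one_div, Real.le_rpow_inv_iff_of_pos hm (by positivity) hs']
      rw [inv_mul_eq_div, le_div_iff₀ ha]
      linarith
    have h2 : b * (a⁻¹ * b) ^ (1 / (s - 1)) = a⁻¹ ^ (1 / (s - 1)) * b ^ s.conjExponent := by
      rw [Real.mul_rpow (by positivity) hb, mul_left_comm, ← Real.rpow_one_add' hb (by positivity)]
      congr 2
      rw [Real.conjExponent]; field_simp; ring
    have h3 : 0 ≤ a * m ^ s := by positivity
    have := mul_le_mul_of_nonneg_left h1 hb
    linarith

lemma HamiltonianHyp.one_lt_conjExponent (hH : HamiltonianHyp H r) : 1 < r.conjExponent := by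
  have := hH.one_lt
  rw [Real.conjExponent, lt_div_iff₀ (by linarith)]; linarith

/-- Besides the upper growth of `H*`, this provides the boundedness without which the real-valued
supremum in `conjH` would be a default value. -/
lemma HamiltonianHyp.exists_inner_sub_le (hH : HamiltonianHyp H r) :
    ∃ K ≥ 0, ∀ x v p, inner ℝ p v - H x p ≤ K * ‖v‖ ^ r.conjExponent + K := by
  obtain ⟨C, hC, hg⟩ := hH.growth
  obtain ⟨K, hK, hy⟩ := exists_mul_le_rpow_add hH.one_lt (one_div_pos.2 hC)
  refine ⟨K + C, by positivity, fun x v p => ?_⟩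
  have h1 := hy ‖p‖ ‖v‖ (norm_nonneg _) (norm_nonneg _)
  have h2 := real_inner_le_norm p v
  have h3 := (hg x p).1
  have h4 : 0 ≤ C * ‖v‖ ^ r.conjExponent := by positivity
  nlinarith

lemma HamiltonianHyp.bddAbove_conjH (hH : HamiltonianHyp H r) (x : T d) (v : E d) :
    BddAbove (range fun p : E d => inner ℝ p v - H x p) := by
  obtain ⟨K, -, hK⟩ := hH.exists_inner_sub_le
  exact ⟨_, by rintro _ ⟨p, rfl⟩; exact hK x v p⟩

lemma HamiltonianHyp.le_conjH (hH : HamiltonianHyp H r) (x : T d) (v p : E d) :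
    inner ℝ p v - H x p ≤ conjH H x v :=
  le_ciSup (hH.bddAbove_conjH x v) p

lemma HamiltonianHyp.exists_conjH_le (hH : HamiltonianHyp H r) :
    ∃ K ≥ 0, ∀ x v, conjH H x v ≤ K * ‖v‖ ^ r.conjExponent + K := by
  obtain ⟨K, hK, h⟩ := hH.exists_inner_sub_le
  exact ⟨K, hK, fun x v => ciSup_le (h x v)⟩

lemma HamiltonianHyp.exists_le_conjH (hH : HamiltonianHyp H r) :
    ∃ c > 0, ∃ K ≥ 0, ∀ x v, c * ‖v‖ ^ r.conjExponent - K ≤ conjH H x v := by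
  obtain ⟨C, hC, hg⟩ := hH.growth
  have hr := hH.one_lt
  have hr' := hH.one_lt_conjExponent
  have hr1 : 0 < r - 1 := by linarith
  set s := r.conjExponent with hs
  -- `l` solves `C l^r = l/2`. For `p` parallel to `v` with `|p| = l |v|^(s-1)`, the cost `C |p|^r`
  -- then consumes exactly half of `p · v = l |v|^s`.
  set l : ℝ := (1 / (2 * C)) ^ (1 / (r - 1)) with hl
  have hlpos : 0 < l := by positivity
  have hlr : C * l ^ r = l / 2 := by
    have h1 : l ^ (r - 1) = 1 / (2 * C) := by
      rw [hl, ← Real.rpow_mul (by positivity), one_div_mul_cancel hr1.ne', Real.rpow_one]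
    have h2 : l ^ r = l ^ (r - 1) * l := by
      rw [← Real.rpow_add_one hlpos.ne']; ring_nf
    rw [h2, h1]; field_simp
  refine ⟨l / 2, by positivity, C, hC.le, fun x v => ?_⟩
  rcases eq_or_ne v 0 with rfl | hv
  · have h1 := hH.le_conjH x 0 0
    have h2 := (hg x 0).2
    rw [norm_zero, Real.zero_rpow (by linarith)] at h2
    rw [norm_zero, Real.zero_rpow (by linarith)]
    simp only [inner_zero_right] at h1
    linarith
  · have hv' : 0 < ‖v‖ := norm_pos_iff.2 hv
    set p : E d := (l * ‖v‖ ^ (s - 2)) • v with hp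
    have h1 : inner ℝ p v = l * ‖v‖ ^ s := by
      rw [hp, real_inner_smul_left, real_inner_self_eq_norm_sq, mul_assoc,
        ← Real.rpow_natCast ‖v‖ 2, ← Real.rpow_add hv']
      norm_num
    have h2 : ‖p‖ = l * ‖v‖ ^ (s - 1) := by
      rw [hp, norm_smul, Real.norm_of_nonneg (by positivity), mul_assoc,
        ← Real.rpow_add_one hv'.ne']
      ring_nf
    have h3 : ‖p‖ ^ r = l ^ r * ‖v‖ ^ s := by
      rw [h2, Real.mul_rpow hlpos.le (by positivity), ← Real.rpow_mul hv'.le]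
      congr 2
      rw [hs, Real.conjExponent]; field_simp; ring
    have h4 := hH.le_conjH x v p
    have h5 := (hg x p).2
    rw [h3, ← mul_assoc, hlr] at h5
    rw [h1] at h4
    linarith

/-- A supremum of continuous functions is lower semicontinuous. -/
lemma HamiltonianHyp.measurable_conjH (hH : HamiltonianHyp H r) :
    Measurable fun z : T d × E d => conjH H z.1 z.2 := by
  refine LowerSemicontinuous.measurable ?_
  refine lowerSemicontinuous_ciSup (fun z => hH.bddAbove_conjH z.1 z.2) fun p => ?_
  refine Continuous.lowerSemicontinuous ?_
  have := hH.continuous.comp (continuous_fst.prodMk continuous_const :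
    Continuous fun z : T d × E d => (z.1, p))
  have h2 : Continuous fun z : T d × E d => inner ℝ p z.2 := by fun_prop
  exact h2.sub this

/-- The perspective of the conjugate Hamiltonian is bounded below by linear functions. -/
lemma HamiltonianHyp.neg_inner_sub_le (hH : HamiltonianHyp H r) (x : T d) {m : ℝ} (hm : 0 ≤ m)
    {w : E d} (hw : m = 0 → w = 0) (p : E d) :
    -inner ℝ p w - m * H x p ≤ m * conjH H x (-(m⁻¹ • w)) := by
  rcases hm.eq_or_lt with rfl | hm'
  · simp [hw rfl]
  · have := mul_le_mul_of_nonneg_left (hH.le_conjH x (-(m⁻¹ • w)) p) hm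
    rw [mul_sub, inner_neg_right, real_inner_smul_right, mul_neg,
      mul_inv_cancel_left₀ hm'.ne'] at this
    exact this

/-- For each `p` the minorant `-p · w - m H(x,p)` is linear in `(m, w)`, and at positive mass the
perspective is the supremum of these minorants. -/
lemma HamiltonianHyp.midpoint_le (hH : HamiltonianHyp H r) (x : T d) {m₁ m₂ : ℝ} (hm₁ : 0 ≤ m₁)
    (hm₂ : 0 ≤ m₂) {w₁ w₂ : E d} (hw₁ : m₁ = 0 → w₁ = 0) (hw₂ : m₂ = 0 → w₂ = 0) :
    2 * (((m₁ + m₂) / 2) * conjH H x (-(((m₁ + m₂) / 2)⁻¹ • ((1 / 2 : ℝ) • (w₁ + w₂))))) ≤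
      m₁ * conjH H x (-(m₁⁻¹ • w₁)) + m₂ * conjH H x (-(m₂⁻¹ • w₂)) := by
  rcases (add_nonneg hm₁ hm₂).eq_or_lt with h | h
  · have h1 : m₁ = 0 := by linarith
    have h2 : m₂ = 0 := by linarith
    simp [h1, h2]
  · have hM : 0 < (m₁ + m₂) / 2 := by linarith
    rw [← mul_assoc, ← le_div_iff₀' (by positivity)]
    refine ciSup_le fun p => ?_
    rw [le_div_iff₀' (by positivity)]
    have h1 := hH.neg_inner_sub_le x hm₁ hw₁ p
    have h2 := hH.neg_inner_sub_le x hm₂ hw₂ p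
    refine le_trans (le_of_eq ?_) (add_le_add h1 h2)
    rw [inner_neg_right, real_inner_smul_right, real_inner_smul_right, inner_add_right]
    field_simp
    ring

/-! ### The primitive of the coupling -/

lemma CouplingHyp.continuousOn_right (hf : CouplingHyp f q) (x : T d) :
    ContinuousOn (f x) (Ici 0) :=
  hf.continuousOn.comp (f := fun s : ℝ => (x, s)) (by fun_prop) fun _ hs => ⟨trivial, hs⟩

lemma CouplingHyp.intervalIntegrable (hf : CouplingHyp f q) (x : T d) {a b : ℝ} (ha : 0 ≤ a)
    (hb : 0 ≤ b) : IntervalIntegrable (f x) volume a b :=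
  ((hf.continuousOn_right x).mono fun _ hs => (le_min ha hb).trans hs.1).intervalIntegrable

lemma CouplingHyp.exists_primF_bounds (hf : CouplingHyp f q) :
    ∃ c > 0, ∃ K ≥ 0, ∀ x m, 0 ≤ m →
      c * m ^ q - K * m ≤ primF f x m ∧ primF f x m ≤ K * m ^ q + K * m := by
  obtain ⟨C, hC, hg⟩ := hf.growth
  have hq := hf.one_lt
  refine ⟨1 / C / q, by positivity, C + C / q, by positivity, fun x m hm => ?_⟩
  have hi : ∀ a b : ℝ, IntervalIntegrable (fun s : ℝ => a * s ^ (q - 1) + b) volume 0 m :=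
    fun a b => ((intervalIntegral.intervalIntegrable_rpow' (by linarith)).const_mul a).add
      intervalIntegrable_const
  have hI : ∀ a b : ℝ, ∫ s in (0 : ℝ)..m, (a * s ^ (q - 1) + b) = a / q * m ^ q + b * m := by
    intro a b
    rw [intervalIntegral.integral_add
      ((intervalIntegral.intervalIntegrable_rpow' (by linarith)).const_mul a)
      intervalIntegrable_const, intervalIntegral.integral_const_mul,
      integral_rpow (Or.inl (by linarith))]
    simp only [sub_add_cancel, Real.zero_rpow (by linarith : q ≠ 0),
      intervalIntegral.integral_const, smul_eq_mul]
    ring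
  have hmq : 0 ≤ m ^ q := by positivity
  constructor
  · have := intervalIntegral.integral_mono_on hm (hi (1 / C) (-C))
      (hf.intervalIntegrable x le_rfl hm) fun s hs => (hg x s hs.1).1
    rw [hI] at this
    have h2 : 0 ≤ C / q * m := by positivity
    rw [primF]
    linarith
  · have := intervalIntegral.integral_mono_on hm (hf.intervalIntegrable x le_rfl hm)
      (hi C C) fun s hs => (hg x s hs.1).2
    rw [hI] at this
    have h2 : 0 ≤ C / q * m := by positivity
    have h3 : 0 ≤ C * m ^ q := by positivity
    rw [primF]
    linarith

/-- Truncating at `0` gives a function continuous on the whole line, although `f` is controlled only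
for nonnegative masses. -/
lemma CouplingHyp.continuous_primF_max (hf : CouplingHyp f q) :
    Continuous fun z : T d × ℝ => primF f z.1 (max z.2 0) := by
  have h1 : Continuous (Function.uncurry fun (z : T d × ℝ) (s : ℝ) => f z.1 (max s 0)) :=
    hf.continuousOn.comp_continuous
      (f := fun y : (T d × ℝ) × ℝ => (y.1.1, max y.2 0)) (by fun_prop)
      fun y => ⟨trivial, mem_Ici.2 (le_max_right _ _)⟩
  have h2 := intervalIntegral.continuous_parametric_intervalIntegral_of_continuous (μ := volume)
    (a₀ := 0) h1 (s := fun z => max z.2 0) (by fun_prop)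
  refine h2.congr fun z => ?_
  refine intervalIntegral.integral_congr fun s hs => ?_
  rw [uIcc_of_le (le_max_right _ _)] at hs
  simp [max_eq_left hs.1]

lemma CouplingHyp.primF_add_mul_sub_le (hf : CouplingHyp f q) (x : T d) {m m' : ℝ} (hm : 0 ≤ m)
    (hm' : 0 ≤ m') : primF f x m + f x m * (m' - m) ≤ primF f x m' := by
  have h1 : primF f x m' = primF f x m + ∫ s in m..m', f x s :=
    (intervalIntegral.integral_add_adjacent_intervals (hf.intervalIntegrable x le_rfl hm)
      (hf.intervalIntegrable x hm hm')).symm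
  have hmono := (hf.strictMonoOn x).monotoneOn
  rw [h1]
  gcongr
  rcases le_total m m' with h | h
  · have := intervalIntegral.integral_mono_on h (intervalIntegrable_const (c := f x m))
      (hf.intervalIntegrable x hm hm') fun s hs => hmono hm (hm.trans hs.1) hs.1
    rw [intervalIntegral.integral_const, smul_eq_mul] at this
    linarith
  · have := intervalIntegral.integral_mono_on h (hf.intervalIntegrable x hm' hm)
      (intervalIntegrable_const (c := f x m)) fun s hs => hmono (hm'.trans hs.1) hm hs.2
    rw [intervalIntegral.integral_const, smul_eq_mul] at this
    rw [intervalIntegral.integral_symm]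
    linarith

/-- The equality case of Fenchel's inequality: `f(x,m)` is the slope of the convex function `F(x,·)`
at `m`. -/
lemma CouplingHyp.conjF_apply_le (hf : CouplingHyp f q) (x : T d) {m : ℝ} (hm : 0 ≤ m) :
    conjF f x (f x m) ≤ f x m * m - primF f x m :=
  ciSup_le fun m' => by
    have := hf.primF_add_mul_sub_le x hm m'.2
    simp only [NNReal.val_eq_coe] at this
    linarith

/-! ### The function `J` -/

variable {J Jt : ℝ → ℝ} {c₀ : ℝ}

/-- At `a = f(x,m)` the Fenchel gap of `m` closes, which forces `Jt (f x m) = J m`. The gap of `m'`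
at the same slope is then at most the Bregman distance of `F(x,·)` from `m` to `m'`, and `Jt`
disappears from the estimate. -/
lemma CouplingHyp.sq_sub_le (hf : CouplingHyp f q) (hc₀ : 0 < c₀)
    (hJ : ∀ (x : T d) (m a : ℝ), 0 ≤ m → min 0 (f x 0) ≤ a →
      c₀ * |J m - Jt a| ^ 2 ≤ primF f x m + conjF f x a - m * a)
    (x : T d) {m m' : ℝ} (hm : 0 ≤ m) (hm' : 0 ≤ m') :
    c₀ * (J m' - J m) ^ 2 ≤ primF f x m' - primF f x m - f x m * (m' - m) := by
  have hmin : min 0 (f x 0) ≤ f x m :=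
    (min_le_right _ _).trans ((hf.strictMonoOn x).monotoneOn self_mem_Ici hm hm)
  have hconj := hf.conjF_apply_le x hm
  have h1 := hJ x m (f x m) hm hmin
  have h2 := hJ x m' (f x m) hm' hmin
  rw [sq_abs] at h1 h2
  have h3 : (J m - Jt (f x m)) ^ 2 = 0 := by nlinarith [sq_nonneg (J m - Jt (f x m))]
  have h4 : Jt (f x m) = J m := by linarith [pow_eq_zero_iff (two_ne_zero) |>.1 h3]
  rw [h4] at h2
  linarith

/-- The Bregman distance, taken at a single point of the torus, tends to `0` as `m → m₀` and
dominates the squared increment of `J`. Measurability of `J(m)` rests on this. -/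
lemma CouplingHyp.continuous_comp_max_of_gap (hf : CouplingHyp f q) (hc₀ : 0 < c₀)
    (hJ : ∀ (x : T d) (m a : ℝ), 0 ≤ m → min 0 (f x 0) ≤ a →
      c₀ * |J m - Jt a| ^ 2 ≤ primF f x m + conjF f x a - m * a) :
    Continuous fun m => J (max m 0) := by
  rw [continuous_iff_continuousAt]
  intro m₀
  rw [ContinuousAt, tendsto_iff_norm_sub_tendsto_zero]
  let g : ℝ → ℝ := fun m => √((primF f 0 (max m 0) - primF f 0 (max m₀ 0) -
    f 0 (max m₀ 0) * (max m 0 - max m₀ 0)) / c₀)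
  have hg : Continuous g := by
    have : Continuous fun m : ℝ => primF f 0 (max m 0) :=
      hf.continuous_primF_max.comp (continuous_const.prodMk continuous_id)
    fun_prop
  have hg0 : g m₀ = 0 := by simp [g]
  refine squeeze_zero (fun _ => norm_nonneg _) (fun m => ?_) (hg0 ▸ hg.tendsto m₀)
  refine Real.le_sqrt_of_sq_le ?_
  rw [Real.norm_eq_abs, sq_abs, le_div_iff₀' hc₀]
  exact hf.sq_sub_le hc₀ hJ 0 (le_max_right _ _) (le_max_right _ _)

end

section

variable {d : ℕ} {f : T d → ℝ → ℝ} {H : T d → E d → ℝ} {q r : ℝ}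

/-! ### The energy density -/

/-- The integrand `m H*(x, -w/m) + F(x,m)` as a function of the point, the mass and the flux. -/
def density (f : T d → ℝ → ℝ) (H : T d → E d → ℝ) (x : T d) (m : ℝ) (w : E d) : ℝ :=
  m * conjH H x (-(m⁻¹ • w)) + primF f x m

/-- The model density `m |w/m| ^ (r / (r - 1)) + m ^ q`. -/
def modelDensity (q r m : ℝ) (w : E d) : ℝ := m * ‖m⁻¹ • w‖ ^ r.conjExponent + m ^ q

lemma modelDensity_nonneg {m : ℝ} (hm : 0 ≤ m) (w : E d) : 0 ≤ modelDensity q r m w := by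
  unfold modelDensity; positivity

lemma exists_le_density (hf : CouplingHyp f q) (hH : HamiltonianHyp H r) :
    ∃ c > 0, ∃ K ≥ 0, ∀ (x : T d) (m : ℝ) (w : E d), 0 ≤ m →
      c * modelDensity q r m w - K ≤ density f H x m w := by
  obtain ⟨c₁, hc₁, K₁, hK₁, h1⟩ := hH.exists_le_conjH
  obtain ⟨c₂, hc₂, K₂, hK₂, h2⟩ := hf.exists_primF_bounds
  obtain ⟨K₃, hK₃, h3⟩ := exists_mul_le_rpow_add hf.one_lt (half_pos hc₂)
  refine ⟨min c₁ (c₂ / 2), by positivity, K₃ * (K₁ + K₂) ^ q.conjExponent, by positivity,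
    fun x m w hm => ?_⟩
  have a1 := mul_le_mul_of_nonneg_left (h1 x (-(m⁻¹ • w))) hm
  rw [norm_neg] at a1
  have a2 := (h2 x m hm).1
  have a3 := h3 m (K₁ + K₂) hm (by positivity)
  have b1 : min c₁ (c₂ / 2) * (m * ‖m⁻¹ • w‖ ^ r.conjExponent) ≤
      c₁ * (m * ‖m⁻¹ • w‖ ^ r.conjExponent) :=
    mul_le_mul_of_nonneg_right (min_le_left _ _) (by positivity)
  have b2 : min c₁ (c₂ / 2) * m ^ q ≤ c₂ / 2 * m ^ q :=
    mul_le_mul_of_nonneg_right (min_le_right _ _) (by positivity)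
  unfold modelDensity density
  linarith

lemma CouplingHyp.exists_le_rpow_add (hf : CouplingHyp f q) :
    ∃ K ≥ 0, ∀ m : ℝ, 0 ≤ m → m ≤ m ^ q + K := by
  obtain ⟨K, hK, h⟩ := exists_mul_le_rpow_add hf.one_lt one_pos
  exact ⟨K, hK, fun m hm => by simpa using h m 1 hm zero_le_one⟩

/-- The bound is uniform in `x`, so integrability for a pair `(m, w)` survives any shift of the
explicit `x`-dependence. -/
lemma exists_abs_density_le (hf : CouplingHyp f q) (hH : HamiltonianHyp H r) :
    ∃ K ≥ 0, ∀ (x : T d) (m : ℝ) (w : E d), 0 ≤ m →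
      |density f H x m w| ≤ K * (modelDensity q r m w + 1) := by
  obtain ⟨c, hc, K₀, hK₀, h0⟩ := exists_le_density hf hH
  obtain ⟨K₁, hK₁, h1⟩ := hH.exists_conjH_le
  obtain ⟨c₂, hc₂, K₂, hK₂, h2⟩ := hf.exists_primF_bounds
  obtain ⟨K₃, hK₃, h3⟩ := hf.exists_le_rpow_add
  refine ⟨K₀ + K₁ + 2 * K₂ + K₃ * (K₁ + K₂), by positivity, fun x m w hm => ?_⟩
  have hP := modelDensity_nonneg (q := q) (r := r) hm w
  have hX : 0 ≤ m * ‖m⁻¹ • w‖ ^ r.conjExponent := by positivity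
  have hY : 0 ≤ m ^ q := by positivity
  rw [abs_le]
  constructor
  · have h4 := h0 x m w hm
    have h5 : 0 ≤ (K₁ + 2 * K₂ + K₃ * (K₁ + K₂)) * (modelDensity q r m w + 1) := by positivity
    have h6 : 0 ≤ c * modelDensity q r m w := by positivity
    have h7 : 0 ≤ K₀ * modelDensity q r m w := by positivity
    linarith
  · have a1 := mul_le_mul_of_nonneg_left (h1 x (-(m⁻¹ • w))) hm
    rw [norm_neg] at a1
    have a2 := (h2 x m hm).2
    have a3 := mul_le_mul_of_nonneg_left (h3 m hm) (add_nonneg hK₁ hK₂)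
    unfold modelDensity density at *
    have h5 : 0 ≤ (K₀ + K₃ * (K₁ + K₂)) * (m * ‖m⁻¹ • w‖ ^ r.conjExponent + m ^ q) := by
      positivity
    have h6 : 0 ≤ K₂ * (m * ‖m⁻¹ • w‖ ^ r.conjExponent) := by positivity
    linarith

lemma exists_second_difference_density_le (hf : CouplingHyp f q)
    (hHdiff : ∀ p : E d, TwiceDiff (fun x => conjH H x p))
    (hFdiff : ∀ m : ℝ, 0 ≤ m → TwiceDiff (fun x => primF f x m))
    (hHF : ∃ C > 0,
      (∀ v h p : E d,
        hess (fun x => conjH H x p) v h ≤ C * (‖p‖ ^ r.conjExponent + 1) * ‖h‖ ^ 2) ∧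
      (∀ (v h : E d) (m : ℝ), 0 ≤ m →
        hess (fun x => primF f x m) v h ≤ C * (m ^ q + 1) * ‖h‖ ^ 2)) :
    ∃ K ≥ 0, ∀ (x : T d) (h : E d) (m : ℝ) (w : E d), 0 ≤ m →
      density f H (x + proj h) m w + density f H (x - proj h) m w - 2 * density f H x m w ≤
        K * (modelDensity q r m w + 1) * ‖h‖ ^ 2 := by
  obtain ⟨C, hC, h1, h2⟩ := hHF
  obtain ⟨K₃, hK₃, h3⟩ := hf.exists_le_rpow_add
  refine ⟨C * (2 + K₃), by positivity, fun x h m w hm => ?_⟩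
  -- The Hessian bound at `p = -w/m` multiplied by `m` yields `m |w/m|^{r'} + m`, and the linear
  -- term is absorbed by `m^q`. At `m = 0` the factor `m` removes the Hamiltonian part.
  have a1 := mul_le_mul_of_nonneg_left ((hHdiff (-(m⁻¹ • w))).second_difference_le h
    (fun v => h1 v h (-(m⁻¹ • w))) x) hm
  have a2 := (hFdiff m hm).second_difference_le h (fun v => h2 v h m hm) x
  rw [norm_neg] at a1
  have a3 : C * (m * ‖m⁻¹ • w‖ ^ r.conjExponent + m + m ^ q + 1) * ‖h‖ ^ 2 ≤
      C * (2 + K₃) * (modelDensity q r m w + 1) * ‖h‖ ^ 2 := by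
    rw [mul_assoc C (2 + K₃)]
    gcongr
    unfold modelDensity
    have := h3 m hm
    have hX : 0 ≤ m * ‖m⁻¹ • w‖ ^ r.conjExponent := by positivity
    have hY : 0 ≤ m ^ q := by positivity
    nlinarith [mul_nonneg hK₃ hX, mul_nonneg hK₃ hY]
  refine le_trans ?_ a3
  unfold density
  linarith

variable {J Jt : ℝ → ℝ} {c₀ : ℝ}

/-- Two Bregman inequalities based at the mean mass are added; their first-order terms cancel, and
the triangle inequality for `J` costs the factor `1/2`. -/
lemma midpoint_density_le (hf : CouplingHyp f q) (hH : HamiltonianHyp H r) (hc₀ : 0 < c₀)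
    (hJ : ∀ (x : T d) (m a : ℝ), 0 ≤ m → min 0 (f x 0) ≤ a →
      c₀ * |J m - Jt a| ^ 2 ≤ primF f x m + conjF f x a - m * a)
    (x : T d) {m₁ m₂ : ℝ} (hm₁ : 0 ≤ m₁)
    (hm₂ : 0 ≤ m₂) {w₁ w₂ : E d} (hw₁ : m₁ = 0 → w₁ = 0) (hw₂ : m₂ = 0 → w₂ = 0) :
    2 * density f H x ((m₁ + m₂) / 2) ((1 / 2 : ℝ) • (w₁ + w₂)) + c₀ / 2 * (J m₂ - J m₁) ^ 2 ≤
      density f H x m₁ w₁ + density f H x m₂ w₂ := by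
  have hM : 0 ≤ (m₁ + m₂) / 2 := by positivity
  have h1 := hf.sq_sub_le hc₀ hJ x hM hm₁
  have h2 := hf.sq_sub_le hc₀ hJ x hM hm₂
  have h3 := hH.midpoint_le x hm₁ hm₂ hw₁ hw₂
  have h4 : c₀ / 2 * (J m₂ - J m₁) ^ 2 ≤
      c₀ * (J m₁ - J ((m₁ + m₂) / 2)) ^ 2 + c₀ * (J m₂ - J ((m₁ + m₂) / 2)) ^ 2 := by
    nlinarith [mul_nonneg hc₀.le (sq_nonneg (J m₁ + J m₂ - 2 * J ((m₁ + m₂) / 2)))]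
  unfold density
  linarith

/-- The Bregman bound based at mass `0` compares `(J m - J 0)²` with `F(0,m) - f(0,0) m`, which
grows at most like `m^q`. -/
lemma exists_sq_le (hf : CouplingHyp f q) (hc₀ : 0 < c₀)
    (hJ : ∀ (x : T d) (m a : ℝ), 0 ≤ m → min 0 (f x 0) ≤ a →
      c₀ * |J m - Jt a| ^ 2 ≤ primF f x m + conjF f x a - m * a) :
    ∃ K ≥ 0, ∀ m : ℝ, 0 ≤ m → J m ^ 2 ≤ K * (m ^ q + 1) := by
  obtain ⟨c₂, hc₂, K₂, hK₂, h2⟩ := hf.exists_primF_bounds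
  obtain ⟨K₃, hK₃, h3⟩ := hf.exists_le_rpow_add
  refine ⟨2 * J 0 ^ 2 + 2 / c₀ * (2 * K₂ + |f 0 0| + K₃ * (K₂ + |f 0 0|)), by positivity,
    fun m hm => ?_⟩
  have h4 := hf.sq_sub_le hc₀ hJ 0 le_rfl hm
  have h5 : primF f (0 : T d) 0 = 0 := by simp [primF]
  have hY : 0 ≤ m ^ q := by positivity
  have h6 := (h2 0 m hm).2
  have h7 : (J m - J 0) ^ 2 ≤
      1 / c₀ * ((2 * K₂ + |f 0 0| + K₃ * (K₂ + |f 0 0|)) * (m ^ q + 1)) := by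
    rw [one_div, inv_mul_eq_div, le_div_iff₀' hc₀]
    have h8 := mul_le_mul_of_nonneg_right (neg_abs_le (f 0 0)) hm
    have h9 := mul_le_mul_of_nonneg_left (h3 m hm) (add_nonneg hK₂ (abs_nonneg (f 0 0)))
    have h10 : 0 ≤ K₃ * (K₂ + |f 0 0|) * m ^ q := by positivity
    have h11 : 0 ≤ |f 0 0| := abs_nonneg _
    linarith
  have h8 : J m ^ 2 ≤ 2 * J 0 ^ 2 + 2 * (J m - J 0) ^ 2 := by nlinarith [sq_nonneg (J m - 2 * J 0)]
  have h9 : 0 ≤ 2 * J 0 ^ 2 * m ^ q := by positivity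
  calc J m ^ 2 ≤ _ := h8
    _ ≤ 2 * J 0 ^ 2 + 2 * (1 / c₀ * ((2 * K₂ + |f 0 0| + K₃ * (K₂ + |f 0 0|)) * (m ^ q + 1))) := by
      gcongr
    _ ≤ _ := by
      have : 2 / c₀ = 2 * (1 / c₀) := by ring
      rw [this]
      linarith

lemma aestronglyMeasurable_density (hf : CouplingHyp f q) (hH : HamiltonianHyp H r)
    {m : T d → ℝ} {w : T d → E d} (hm : AEStronglyMeasurable m) (hw : AEStronglyMeasurable w)
    (hnn : ∀ᵐ x, 0 ≤ m x) (a : T d) :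
    AEStronglyMeasurable (fun x => density f H (x + a) (m x) (w x)) := by
  have ha : AEMeasurable (fun x : T d => x + a) := (measurable_id.add_const a).aemeasurable
  have hv : AEMeasurable fun x => -((m x)⁻¹ • w x) :=
    (hm.aemeasurable.inv.smul hw.aemeasurable).neg
  have h1 := hH.measurable_conjH.comp_aemeasurable (ha.prodMk hv)
  have hF : Measurable fun z : T d × ℝ => primF f z.1 (max z.2 0) :=
    hf.continuous_primF_max.measurable
  have h2 := hF.comp_aemeasurable (ha.prodMk hm.aemeasurable)
  have h3 : AEMeasurable fun x =>
      m x * conjH H (x + a) (-((m x)⁻¹ • w x)) + primF f (x + a) (max (m x) 0) :=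
    (hm.aemeasurable.mul h1).add h2
  refine h3.aestronglyMeasurable.congr ?_
  filter_upwards [hnn] with x hx
  rw [density, max_eq_left hx]

lemma aestronglyMeasurable_modelDensity {m : T d → ℝ} {w : T d → E d}
    (hm : AEStronglyMeasurable m) (hw : AEStronglyMeasurable w) :
    AEStronglyMeasurable (fun x => modelDensity q r (m x) (w x)) :=
  ((hm.aemeasurable.mul ((hm.aemeasurable.inv.smul hw.aemeasurable).norm.pow_const _)).add
    (hm.aemeasurable.pow_const q)).aestronglyMeasurable

end

section

variable {d : ℕ} {f : T d → ℝ → ℝ} {H : T d → E d → ℝ} {q r ε : ℝ}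

/-! ### Admissible pairs -/

lemma CouplingHyp.integrable_of_memLp (hf : CouplingHyp f q) {m : T d → ℝ}
    (hm : MemLp m (ENNReal.ofReal q)) : Integrable m :=
  hm.integrable (ENNReal.one_le_ofReal.2 hf.one_lt.le)

lemma integrable_flux (hf : CouplingHyp f q) (hH : HamiltonianHyp H r) {w : T d → E d}
    (hw : MemLp w (ENNReal.ofReal (r.conjExponent * q / (r.conjExponent + q - 1)))) :
    Integrable w := by
  refine hw.integrable (ENNReal.one_le_ofReal.2 ?_)
  have h1 := hf.one_lt
  have h2 := hH.one_lt_conjExponent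
  rw [le_div_iff₀ (by linarith)]
  -- The exponent of `w` is at least `1` because `r' q - (r' + q - 1) = (r' - 1)(q - 1)`.
  nlinarith [mul_pos (sub_pos.2 h1) (sub_pos.2 h2)]

lemma integrable_inner_continuous {φ : T d → E d} (hφ : Continuous φ) {w : T d → E d}
    (hw : Integrable w) : Integrable fun x => inner ℝ (φ x) (w x) := by
  obtain ⟨M, hM⟩ := isCompact_univ.exists_bound_of_continuousOn hφ.continuousOn
  refine (hw.norm.const_mul M).mono'
    (hφ.aestronglyMeasurable_of_compactSpace.inner hw.aestronglyMeasurable) (.of_forall fun x => ?_)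
  exact (norm_inner_le_norm _ _).trans
    (mul_le_mul_of_nonneg_right (hM x trivial) (norm_nonneg _))

lemma integrable_mul_continuous {ψ : T d → ℝ} (hψ : Continuous ψ) {g : T d → ℝ}
    (hg : Integrable g) : Integrable fun x => g x * ψ x := by
  obtain ⟨M, hM⟩ := isCompact_univ.exists_bound_of_continuousOn hψ.continuousOn
  refine (hg.norm.const_mul M).mono'
    (hg.aestronglyMeasurable.mul hψ.aestronglyMeasurable_of_compactSpace) (.of_forall fun x => ?_)
  rw [norm_mul, mul_comm]
  exact mul_le_mul_of_nonneg_right (hM x trivial) (norm_nonneg _)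

/-- A competitor common to all `ε`, from which every uniform bound descends. -/
lemma admissible_one : Admissible (d := d) q r ε (fun _ => 1) (fun _ => 0) where
  memLp_m := memLp_const _
  memLp_w := memLp_const _
  nonneg := .of_forall fun _ => zero_le_one
  equation ψ _ := by simp

lemma Admissible.translate {m : T d → ℝ} {w : T d → E d} (h : Admissible q r ε m w) (u : E d) :
    Admissible q r ε (fun x => m (x + proj u)) (fun x => w (x + proj u)) where
  memLp_m := h.memLp_m.comp_measurePreserving (measurePreserving_translate _)
  memLp_w := h.memLp_w.comp_measurePreserving (measurePreserving_translate _)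
  nonneg := (measurePreserving_translate (proj u)).quasiMeasurePreserving.ae h.nonneg
  equation ψ hψ := by
    have h1 := h.equation _ (hψ.translate (-u))
    simp only [grad_translate] at h1
    rw [← integral_add_right_eq_self _ (proj u),
      ← integral_add_right_eq_self (fun x => ε * (m x - 1) * ψ (x + proj (-u))) (proj u)] at h1
    simpa [proj_neg] using h1

lemma Admissible.midpoint (hf : CouplingHyp f q) (hH : HamiltonianHyp H r) {m₁ m₂ : T d → ℝ}
    {w₁ w₂ : T d → E d} (h₁ : Admissible q r ε m₁ w₁) (h₂ : Admissible q r ε m₂ w₂) :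
    Admissible q r ε (fun x => (m₁ x + m₂ x) / 2) (fun x => (1 / 2 : ℝ) • (w₁ x + w₂ x)) where
  memLp_m := by
    simpa [div_eq_inv_mul] using (h₁.memLp_m.add h₂.memLp_m).const_mul (2⁻¹ : ℝ)
  memLp_w := (h₁.memLp_w.add h₂.memLp_w).const_smul (1 / 2 : ℝ)
  nonneg := by
    filter_upwards [h₁.nonneg, h₂.nonneg] with x hx₁ hx₂
    positivity
  equation ψ hψ := by
    have hi : ∀ {m : T d → ℝ} {w : T d → E d}, Admissible q r ε m w →
        Integrable (fun x => inner ℝ (grad ψ x) (w x)) ∧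
        Integrable (fun x => ε * (m x - 1) * ψ x) := fun h =>
      ⟨integrable_inner_continuous (hψ.continuous_grad (by simp)) (integrable_flux hf hH h.memLp_w),
        integrable_mul_continuous hψ.continuous
          (((hf.integrable_of_memLp h.memLp_m).sub (integrable_const 1)).const_mul ε)⟩
    have e1 : ∫ x, inner ℝ (grad ψ x) ((1 / 2 : ℝ) • (w₁ x + w₂ x)) =
        1 / 2 * ((∫ x, inner ℝ (grad ψ x) (w₁ x)) + ∫ x, inner ℝ (grad ψ x) (w₂ x)) := by
      rw [← integral_add (hi h₁).1 (hi h₂).1, ← integral_const_mul]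
      simp only [real_inner_smul_right, inner_add_right]
    have e2 : ∫ x, ε * ((m₁ x + m₂ x) / 2 - 1) * ψ x =
        1 / 2 * ((∫ x, ε * (m₁ x - 1) * ψ x) + ∫ x, ε * (m₂ x - 1) * ψ x) := by
      rw [← integral_add (hi h₁).2 (hi h₂).2, ← integral_const_mul]
      congr 1
      ext x
      ring
    rw [e1, e2, h₁.equation ψ hψ, h₂.equation ψ hψ]

/-! ### Minimisers -/

lemma dualB_of_integrable {m : T d → ℝ} {w : T d → E d} (h0 : ∀ᵐ x, m x = 0 → w x = 0)
    (hi : Integrable fun x => density f H x (m x) (w x)) :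
    dualB f H m w = ((∫ x, density f H x (m x) (w x) : ℝ) : EReal) :=
  if_pos ⟨h0, hi⟩

lemma finite_of_dualB_ne_top {m : T d → ℝ} {w : T d → E d} (h : dualB f H m w ≠ ⊤) :
    (∀ᵐ x, m x = 0 → w x = 0) ∧ Integrable fun x => density f H x (m x) (w x) := by
  by_contra hc
  exact h (if_neg hc)

lemma integrable_density (hf : CouplingHyp f q) (hH : HamiltonianHyp H r) {m : T d → ℝ}
    {w : T d → E d} (hm : AEStronglyMeasurable m) (hw : AEStronglyMeasurable w)
    (hnn : ∀ᵐ x, 0 ≤ m x) (hi : Integrable fun x => modelDensity q r (m x) (w x)) (a : T d) :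
    Integrable fun x => density f H (x + a) (m x) (w x) := by
  obtain ⟨K, -, hK⟩ := exists_abs_density_le hf hH
  refine ((hi.add (integrable_const 1)).const_mul K).mono'
    (aestronglyMeasurable_density hf hH hm hw hnn a) ?_
  filter_upwards [hnn] with x hx
  exact hK _ _ _ hx

lemma integrable_density_one (hf : CouplingHyp f q) (hH : HamiltonianHyp H r) :
    Integrable fun x : T d => density f H x 1 0 := by
  have := integrable_density hf hH (m := fun _ => 1) (w := fun _ => 0) aestronglyMeasurable_const
    aestronglyMeasurable_const (.of_forall fun _ => zero_le_one) (integrable_const _) 0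
  simpa using this

lemma IsDualMinimizer.finite (hf : CouplingHyp f q) (hH : HamiltonianHyp H r) {m : T d → ℝ}
    {w : T d → E d} (h : IsDualMinimizer f H q r ε m w) :
    (∀ᵐ x, m x = 0 → w x = 0) ∧ (Integrable fun x => density f H x (m x) (w x)) ∧
      ∫ x, density f H x (m x) (w x) ≤ ∫ x, density f H x 1 0 := by
  have h1 := h.2 _ _ admissible_one
  rw [dualB_of_integrable (.of_forall fun _ => by simp) (integrable_density_one hf hH)] at h1
  obtain ⟨h2, h3⟩ := finite_of_dualB_ne_top (ne_top_of_le_ne_top (EReal.coe_ne_top _) h1)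
  rw [dualB_of_integrable h2 h3] at h1
  exact ⟨h2, h3, EReal.coe_le_coe_iff.1 h1⟩

/-- The energy of minimisers is bounded independently of the discount factor. -/
lemma exists_integral_modelDensity_le (hf : CouplingHyp f q) (hH : HamiltonianHyp H r) :
    ∃ K ≥ 0, ∀ (ε : ℝ) (m : T d → ℝ) (w : T d → E d), IsDualMinimizer f H q r ε m w →
      (Integrable fun x => modelDensity q r (m x) (w x)) ∧
        ∫ x, (modelDensity q r (m x) (w x) + 1) ≤ K := by
  obtain ⟨c, hc, K, hK, h⟩ := exists_le_density hf hH
  -- The constant is the coercivity bound evaluated at the competitor `(1, 0)`, with an absolute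
  -- value only to make it nonnegative.
  refine ⟨|∫ x : T d, (c⁻¹ * (density f H x 1 0 + K) + 1)|, abs_nonneg _, fun ε m w hmin => ?_⟩
  obtain ⟨h0, hi, hle⟩ := hmin.finite hf hH
  have hb : ∀ᵐ x, modelDensity q r (m x) (w x) ≤ c⁻¹ * (density f H x (m x) (w x) + K) := by
    filter_upwards [hmin.1.nonneg] with x hx
    rw [inv_mul_eq_div, le_div_iff₀' hc]
    linarith [h x (m x) (w x) hx]
  have hI : Integrable fun x => modelDensity q r (m x) (w x) := by
    refine ((hi.add (integrable_const K)).const_mul c⁻¹).mono'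
      (aestronglyMeasurable_modelDensity hmin.1.memLp_m.1 hmin.1.memLp_w.1) ?_
    filter_upwards [hb, hmin.1.nonneg] with x hx hx0
    rw [Real.norm_of_nonneg (modelDensity_nonneg hx0 _)]
    exact hx
  refine ⟨hI, le_trans ?_ (le_abs_self _)⟩
  have aux : ∀ g : T d → ℝ, Integrable g → ∫ x, (c⁻¹ * (g x + K) + 1) =
      c⁻¹ * ((∫ x, g x) + ∫ _ : T d, K) + ∫ _ : T d, (1 : ℝ) := fun g hg => by
    have hgK : Integrable fun x => g x + K := hg.add (integrable_const K)
    rw [integral_add (hgK.const_mul c⁻¹) (integrable_const 1), integral_const_mul,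
      integral_add hg (integrable_const K)]
  calc ∫ x, (modelDensity q r (m x) (w x) + 1)
      ≤ ∫ x, (c⁻¹ * (density f H x (m x) (w x) + K) + 1) := by
        refine integral_mono_ae (hI.add (integrable_const 1))
          (((hi.add (integrable_const K)).const_mul c⁻¹).add (integrable_const 1)) ?_
        filter_upwards [hb] with x hx
        simpa using hx
    _ ≤ _ := by
      rw [aux _ hi, aux _ (integrable_density_one hf hH)]
      gcongr

variable {J Jt : ℝ → ℝ} {c₀ : ℝ}

lemma exists_integral_sq_comp_le (hf : CouplingHyp f q) (hc₀ : 0 < c₀)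
    (hJ : ∀ (x : T d) (m a : ℝ), 0 ≤ m → min 0 (f x 0) ≤ a →
      c₀ * |J m - Jt a| ^ 2 ≤ primF f x m + conjF f x a - m * a) :
    ∃ K ≥ 0, ∀ (m : T d → ℝ) (w : T d → E d), AEStronglyMeasurable m → (∀ᵐ x, 0 ≤ m x) →
      (Integrable fun x => modelDensity q r (m x) (w x)) → MemLp (fun x => J (m x)) 2 ∧
        ∫ x, J (m x) ^ 2 ≤ K * ∫ x, (modelDensity q r (m x) (w x) + 1) := by
  obtain ⟨K, hK, h⟩ := exists_sq_le hf hc₀ hJ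
  refine ⟨K, hK, fun m w hm hnn hi => ?_⟩
  have hmeas : AEStronglyMeasurable (fun x => J (m x)) := by
    refine ((hf.continuous_comp_max_of_gap hc₀ hJ).comp_aestronglyMeasurable hm).congr ?_
    filter_upwards [hnn] with x hx
    simp [max_eq_left hx]
  have hb : ∀ᵐ x, J (m x) ^ 2 ≤ K * (modelDensity q r (m x) (w x) + 1) := by
    filter_upwards [hnn] with x hx
    refine (h _ hx).trans ?_
    have : 0 ≤ m x * ‖(m x)⁻¹ • w x‖ ^ r.conjExponent := by positivity
    gcongr
    unfold modelDensity
    linarith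
  have hi1 : Integrable fun x => K * (modelDensity q r (m x) (w x) + 1) :=
    (hi.add (integrable_const 1)).const_mul K
  have hsq : Integrable fun x => J (m x) ^ 2 := by
    refine hi1.mono' (hmeas.pow 2) ?_
    filter_upwards [hb] with x hx
    rwa [Real.norm_of_nonneg (sq_nonneg _)]
  refine ⟨(memLp_two_iff_integrable_sq hmeas).2 hsq, ?_⟩
  rw [← integral_const_mul]
  exact integral_mono_ae hsq hi1 hb

/-- Comparison of a minimiser with the midpoint between it and its translate. -/
lemma IsDualMinimizer.integral_sq_translate_le (hf : CouplingHyp f q) (hH : HamiltonianHyp H r)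
    (hc₀ : 0 < c₀)
    (hJ : ∀ (x : T d) (m a : ℝ), 0 ≤ m → min 0 (f x 0) ≤ a →
      c₀ * |J m - Jt a| ^ 2 ≤ primF f x m + conjF f x a - m * a)
    {m : T d → ℝ} {w : T d → E d} (h : IsDualMinimizer f H q r ε m w)
    (hI : Integrable fun x => modelDensity q r (m x) (w x))
    (hJm : MemLp (fun x => J (m x)) 2) (u : E d) :
    c₀ / 2 * ∫ x, (J (m (x + proj u)) - J (m x)) ^ 2 ≤
      (∫ x, density f H (x + proj (-u)) (m x) (w x)) - ∫ x, density f H x (m x) (w x) := by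
  obtain ⟨h0, hi, -⟩ := h.finite hf hH
  have hadm := h.1
  have hadmu := h.1.translate u
  have hqmp := (measurePreserving_translate (proj u)).quasiMeasurePreserving
  have h0u : ∀ᵐ x, m (x + proj u) = 0 → w (x + proj u) = 0 := hqmp.ae h0
  have hiu : Integrable fun x => density f H x (m (x + proj u)) (w (x + proj u)) := by
    have h1 := integrable_density hf hH hadm.memLp_m.1 hadm.memLp_w.1 hadm.nonneg hI (proj (-u))
    have h2 := (measurePreserving_translate (proj u)).integrable_comp_of_integrable h1
    simpa [Function.comp_def, proj_neg] using h2
  -- Translating the pair by `u` has the same energy as shifting the explicit `x`-dependence by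
  -- `-u`.
  have e1 : ∫ x, density f H x (m (x + proj u)) (w (x + proj u)) =
      ∫ x, density f H (x + proj (-u)) (m x) (w x) := by
    rw [← integral_add_right_eq_self (fun x => density f H (x + proj (-u)) (m x) (w x)) (proj u)]
    simp [proj_neg]
  have hJu : MemLp (fun x => J (m (x + proj u))) 2 :=
    hJm.comp_measurePreserving (measurePreserving_translate (proj u))
  have hJd : Integrable fun x => (J (m (x + proj u)) - J (m x)) ^ 2 := (hJu.sub hJm).integrable_sq
  have hmid := hadm.midpoint hf hH hadmu
  have h0mid : ∀ᵐ x, (m x + m (x + proj u)) / 2 = 0 →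
      (1 / 2 : ℝ) • (w x + w (x + proj u)) = 0 := by
    filter_upwards [h0, h0u, hadm.nonneg, hadmu.nonneg] with x hx hxu hn hnu hs
    rw [hx (by linarith), hxu (by linarith)]
    simp
  have hle : ∀ᵐ x, 2 * density f H x ((m x + m (x + proj u)) / 2)
        ((1 / 2 : ℝ) • (w x + w (x + proj u))) + c₀ / 2 * (J (m (x + proj u)) - J (m x)) ^ 2 ≤
      density f H x (m x) (w x) + density f H x (m (x + proj u)) (w (x + proj u)) := by
    filter_upwards [h0, h0u, hadm.nonneg, hadmu.nonneg] with x hx hxu hn hnu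
    exact midpoint_density_le hf hH hc₀ hJ x hn hnu hx hxu
  obtain ⟨c, hc, K, hK, hlow⟩ := exists_le_density hf hH
  -- The midpoint density lies between the coercivity constant and the densities of the two
  -- endpoints. Its integrability makes the energy of the competitor a genuine integral rather than
  -- `⊤`.
  have himid : Integrable fun x => density f H x ((m x + m (x + proj u)) / 2)
      ((1 / 2 : ℝ) • (w x + w (x + proj u))) := by
    have hmeas := aestronglyMeasurable_density hf hH hmid.memLp_m.1 hmid.memLp_w.1 hmid.nonneg 0
    simp only [add_zero] at hmeas
    refine ((hi.abs.add hiu.abs).add (integrable_const K)).mono' hmeas ?_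
    filter_upwards [hle, hmid.nonneg] with x hx hn
    have h1 := hlow x _ ((1 / 2 : ℝ) • (w x + w (x + proj u))) hn
    have h2 := mul_nonneg hc.le
      (modelDensity_nonneg (q := q) (r := r) hn ((1 / 2 : ℝ) • (w x + w (x + proj u))))
    have h3 : 0 ≤ c₀ / 2 * (J (m (x + proj u)) - J (m x)) ^ 2 := by positivity
    have h4 := le_abs_self (density f H x (m x) (w x))
    have h5 := le_abs_self (density f H x (m (x + proj u)) (w (x + proj u)))
    have h6 := abs_nonneg (density f H x (m x) (w x))
    have h7 := abs_nonneg (density f H x (m (x + proj u)) (w (x + proj u)))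
    simp only [Pi.add_apply]
    rw [Real.norm_eq_abs, abs_le]
    constructor <;> linarith
  have hopt := h.2 _ _ hmid
  rw [dualB_of_integrable h0 hi, dualB_of_integrable h0mid himid, EReal.coe_le_coe_iff] at hopt
  have hintegral :=
    integral_mono_ae ((himid.const_mul 2).add (hJd.const_mul (c₀ / 2))) (hi.add hiu) hle
  rw [integral_add' (himid.const_mul 2) (hJd.const_mul (c₀ / 2)), integral_add' hi hiu,
    integral_const_mul, integral_const_mul, e1] at hintegral
  linarith

lemma IsDualMinimizer.integral_sq_difference_le (hf : CouplingHyp f q) (hH : HamiltonianHyp H r)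
    (hc₀ : 0 < c₀)
    (hJ : ∀ (x : T d) (m a : ℝ), 0 ≤ m → min 0 (f x 0) ≤ a →
      c₀ * |J m - Jt a| ^ 2 ≤ primF f x m + conjF f x a - m * a)
    {K : ℝ} (hK : ∀ (x : T d) (h : E d) (m : ℝ) (w : E d), 0 ≤ m →
      density f H (x + proj h) m w + density f H (x - proj h) m w - 2 * density f H x m w ≤
        K * (modelDensity q r m w + 1) * ‖h‖ ^ 2)
    {m : T d → ℝ} {w : T d → E d} (h : IsDualMinimizer f H q r ε m w)
    (hI : Integrable fun x => modelDensity q r (m x) (w x))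
    (hJm : MemLp (fun x => J (m x)) 2) (u : E d) :
    c₀ / 2 * ∫ x, (J (m (x + proj u)) - J (m x)) ^ 2 ≤
      K * (∫ x, (modelDensity q r (m x) (w x) + 1)) * ‖u‖ ^ 2 := by
  obtain ⟨h0, hi, -⟩ := h.finite hf hH
  have h1 := h.integral_sq_translate_le hf hH hc₀ hJ hI hJm u
  have h2 := h.integral_sq_translate_le hf hH hc₀ hJ hI hJm (-u)
  rw [neg_neg] at h2
  -- Each translation estimate alone has a first-order difference on its right side. Adding the one
  -- for `-u`, whose left side is simply dropped, symmetrises this into a second difference.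
  have h3 : 0 ≤ c₀ / 2 * ∫ x, (J (m (x + proj (-u))) - J (m x)) ^ 2 :=
    mul_nonneg (by positivity) (integral_nonneg fun _ => sq_nonneg _)
  have hia := integrable_density hf hH h.1.memLp_m.1 h.1.memLp_w.1 h.1.nonneg hI
  have h4 : (∫ x, density f H (x + proj u) (m x) (w x)) +
      (∫ x, density f H (x + proj (-u)) (m x) (w x)) - 2 * ∫ x, density f H x (m x) (w x) =
      ∫ x, (density f H (x + proj u) (m x) (w x) + density f H (x + proj (-u)) (m x) (w x) -
        2 * density f H x (m x) (w x)) := by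
    have hsum : Integrable fun x => density f H (x + proj u) (m x) (w x) +
        density f H (x + proj (-u)) (m x) (w x) := (hia _).add (hia _)
    rw [integral_sub hsum (hi.const_mul 2), integral_add (hia _) (hia _),
      integral_const_mul]
  have h5 : ∫ x, (density f H (x + proj u) (m x) (w x) + density f H (x + proj (-u)) (m x) (w x) -
        2 * density f H x (m x) (w x)) ≤
      ∫ x, K * (modelDensity q r (m x) (w x) + 1) * ‖u‖ ^ 2 := by
    refine integral_mono_ae (((hia _).add (hia _)).sub (hi.const_mul 2))
      (((hI.add (integrable_const 1)).const_mul K).mul_const _) ?_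
    filter_upwards [h.1.nonneg] with x hx
    simpa [proj_neg, ← sub_eq_add_neg] using hK x u (m x) (w x) hx
  rw [integral_mul_const, integral_const_mul] at h5
  linarith

lemma eLpNorm_two_le {u : T d → ℝ} (hu : MemLp u 2) {A : ℝ} (h : ∫ x, u x ^ 2 ≤ A) :
    eLpNorm u 2 volume ≤ ENNReal.ofReal √A := by
  rw [← ENNReal.ofReal_toReal hu.2.ne, ← Lp.norm_toLp u hu, norm_toLp_two]
  exact ENNReal.ofReal_le_ofReal (Real.sqrt_le_sqrt h)

end

end DiscountMFG

end

/-! ### The uniform `H¹` estimate -/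

open DiscountMFG in
theorem propositionA1 {d : ℕ} (f : T d → ℝ → ℝ) (H : T d → E d → ℝ) (q r : ℝ)
    (hf : CouplingHyp f q) (hH : HamiltonianHyp H r)
    (hHdiff : ∀ p : E d, TwiceDiff (fun x => conjH H x p))
    (hFdiff : ∀ m : ℝ, 0 ≤ m → TwiceDiff (fun x => primF f x m))
    (J Jt : ℝ → ℝ) (c₀ : ℝ) (hc₀ : 0 < c₀)
    (hJ : ∀ (x : T d) (m a : ℝ), 0 ≤ m → min 0 (f x 0) ≤ a →
      c₀ * |J m - Jt a| ^ 2 ≤ primF f x m + conjF f x a - m * a)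
    (hHF : ∃ C > 0,
      (∀ v h p : E d,
        hess (fun x => conjH H x p) v h ≤ C * (‖p‖ ^ r.conjExponent + 1) * ‖h‖ ^ 2) ∧
      (∀ (v h : E d) (m : ℝ), 0 ≤ m →
        hess (fun x => primF f x m) v h ≤ C * (m ^ q + 1) * ‖h‖ ^ 2)) :
    ∃ C : ℝ≥0, ∀ (ε : ℝ), 0 < ε → ∀ (m : T d → ℝ) (w : T d → E d),
      IsDualMinimizer f H q r ε m w →
        MemH1 (fun x => J (m x)) ∧ h1Norm (fun x => J (m x)) ≤ C := by
  obtain ⟨S, hS, hmodel⟩ := exists_integral_modelDensity_le hf hH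
  obtain ⟨K₁, hK₁, hL2⟩ := exists_integral_sq_comp_le (r := r) hf hc₀ hJ
  obtain ⟨K₂, hK₂, hsecond⟩ := exists_second_difference_density_le (r := r) hf hHdiff hFdiff hHF
  set A : ℝ≥0∞ := ENNReal.ofReal √(K₁ * S)
  -- `B²` is `K₂ S` divided by the convexity constant `c₀/2`, so `B |u|` bounds the `L²` size of a
  -- translation difference; neither constant depends on `ε`.
  set B : ℝ := √(2 / c₀ * (K₂ * S)) with hB
  set C : ℝ≥0∞ := (A ^ 2 + (d * ENNReal.ofReal B) ^ 2) ^ (1 / 2 : ℝ) with hC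
  have hCtop : C ≠ ⊤ := by
    refine ENNReal.rpow_ne_top_of_nonneg (by norm_num) (ENNReal.add_ne_top.2 ⟨?_, ?_⟩)
    · exact ENNReal.pow_ne_top ENNReal.ofReal_ne_top
    · exact ENNReal.pow_ne_top (ENNReal.mul_ne_top (ENNReal.natCast_ne_top d) ENNReal.ofReal_ne_top)
  refine ⟨C.toNNReal, fun ε _ m w hmin => ?_⟩
  obtain ⟨hI, hIS⟩ := hmodel ε m w hmin
  obtain ⟨hJm, hJint⟩ := hL2 m w hmin.1.memLp_m.1 hmin.1.nonneg hI
  have hdiff : ∀ u : E d, ∫ x, (J (m (x + proj u)) - J (m x)) ^ 2 ≤ (B * ‖u‖) ^ 2 := fun u => by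
    have h1 := hmin.integral_sq_difference_le hf hH hc₀ hJ hsecond hI hJm u
    have h2 : K₂ * (∫ x, (modelDensity q r (m x) (w x) + 1)) * ‖u‖ ^ 2 ≤ K₂ * S * ‖u‖ ^ 2 := by
      gcongr
    rw [mul_pow, hB, Real.sq_sqrt (by positivity)]
    calc _ = 2 / c₀ * (c₀ / 2 * ∫ x, (J (m (x + proj u)) - J (m x)) ^ 2) := by field_simp
      _ ≤ 2 / c₀ * (K₂ * S * ‖u‖ ^ 2) := mul_le_mul_of_nonneg_left (h1.trans h2) (by positivity)
      _ = _ := by ring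
  obtain ⟨G, hG, hG2, hGn⟩ := exists_weakGrad_of_difference_le hJm (Real.sqrt_nonneg _) hdiff
  refine ⟨⟨hJm, G, hG, hG2⟩, ?_⟩
  rw [ENNReal.coe_toNNReal hCtop]
  refine (iInf₂_le G hG).trans ?_
  have hn := eLpNorm_two_le hJm (hJint.trans (mul_le_mul_of_nonneg_left hIS hK₁))
  rw [hC]
  gcongr
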